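/- Conventions. A graph of groups $\Lambda$ consists of a connected oriented graph (possibly infinite, loops and multiple edges allowed) with edge set $E(\Lambda)$, vertex set $V(\Lambda)$ and end point maps $\iota,\tau:E(\Lambda)\to V(\Lambda)$, vertex groups $\Lambda(V)$, edge groups $\Lambda(E)\le\Lambda(\iota(E))$, and injective homomorphisms $\Lambda(E)\to\Lambda(\tau(E))$, $g\mapsto g^{t_E}$. Its fundamental group is generated by the disjoint union of the vertex groups and a letter $t_E$ for each edge $E$, subject to the relations of the vertex groups, the relations $g\,t_E=t_E\,g^{t_E}$ for all edges $E$ and all $g\in\Lambda(E)$, and $t_E=1$ for all $E$ in a given spanning tree. A graph of groups decomposition of a group $G$ is a graph of groups together with an isomorphism of its fundamental group with $G$; its vertex groups and its edge groups $\Lambda(E)\le\Lambda(\iota(E))$ are identified with their images in $G$. A graph of groups is reduced if, for each edge $E$ that is not a loop, $\Lambda(E)\neq\Lambda(\iota(E))$ and $\Lambda(E)^{t_E}\neq\Lambda(\tau(E))$. Theorem. Suppose $(W,S)$ is a Coxeter system with $S$ finite, $\Lambda$ is a graph of groups decomposition of $W$, and $\Psi$ is a reduced graph of groups decomposition of $W$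 such that each vertex group of $\Psi$ is a subgroup of a conjugate (in $W$) of a vertex group of $\Lambda$. Then for each vertex $V$ of $\Lambda$, the vertex group $\Lambda(V)$ has a graph of groups decomposition $\Phi_V$ such that each vertex group of $\Phi_V$ is either (1) conjugate in $W$ to a vertex group of $\Psi$, or (2) a subgroup of $v\Lambda(E)v^{-1}$ for some $v\in\Lambda(V)$ and some edge $E$ of $\Lambda$ adjacent to $V$. -/

import Mathlib

open scoped Pointwise

universe v e g w uB uW v₁ e₁ g₁ v₂ e₂ g₂

/-- A graph of groups: a connected oriented multigraph (loops and multiple edges are allowed, the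
graph need not be finite), a group at each vertex, for each edge a subgroup of the group of its
initial vertex, and for each edge an injective homomorphism (the edge map) from the edge group to
the group of the terminal vertex. -/
structure GraphOfGroups where
  /-- The vertices. -/
  V : Type v
  /-- The edges. -/
  E : Type e
  /-- The initial vertex of an edge. -/
  init : E → V
  /-- The terminal vertex of an edge. -/
  term : E → V
  /-- The underlying graph is connected (in particular it has a vertex). -/
  connected : (SimpleGraph.fromEdgeSet (Set.range fun E' : E => s(init E', term E'))).Connected
  /-- The vertex groups. -/
  vertexGroup : V → Type g
  [groupVertex : ∀ P, Group (vertexGroup P)]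
  /-- The edge groups. -/
  edgeGroup : ∀ E' : E, Subgroup (vertexGroup (init E'))
  /-- The edge maps. -/
  edgeMap : ∀ E' : E, edgeGroup E' →* vertexGroup (term E')
  edgeMap_injective : ∀ E', Function.Injective (edgeMap E')

namespace GraphOfGroups

attribute [instance] GraphOfGroups.groupVertex

variable (Λ : GraphOfGroups.{v, e, g})

/-- A set `T` of edges is (the edge set of) a spanning tree of the underlying graph: it contains no
loops and no two parallel edges, and the simple graph on all vertices that it spans is a tree. -/
structure IsSpanningTree (T : Set Λ.E) : Prop where
  not_loop : ∀ E ∈ T, Λ.init E ≠ Λ.term E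
  not_parallel : ∀ E ∈ T, ∀ E' ∈ T, s(Λ.init E, Λ.term E) = s(Λ.init E', Λ.term E') → E = E'
  isTree : (SimpleGraph.fromEdgeSet ((fun E => s(Λ.init E, Λ.term E)) '' T)).IsTree

/-- The generators of the fundamental group: the disjoint union of the vertex groups, together
with a letter `t_E` for each edge `E`. -/
abbrev Generator : Type (max v e g) := (Σ P : Λ.V, Λ.vertexGroup P) ⊕ Λ.E

/-- The generator given by an element of a vertex group. -/
def vertexLetter (P : Λ.V) (a : Λ.vertexGroup P) : FreeGroup Λ.Generator :=
  FreeGroup.of (Sum.inl ⟨P, a⟩)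

/-- The generator `t_E`. -/
def edgeLetter (E : Λ.E) : FreeGroup Λ.Generator :=
  FreeGroup.of (Sum.inr E)

/-- The defining relators of the fundamental group with respect to a set `T` of edges. -/
inductive IsRelator (T : Set Λ.E) : FreeGroup Λ.Generator → Prop
  /-- The relations `a · b = ab` of each vertex group. -/
  | vertex (P : Λ.V) (a b : Λ.vertexGroup P) :
      IsRelator T (Λ.vertexLetter P a * Λ.vertexLetter P b * (Λ.vertexLetter P (a * b))⁻¹)
  /-- The relations `a t_E = t_E (edgeMap a)` for `a` in the edge group of `E`. -/
  | edge (E : Λ.E) (a : Λ.edgeGroup E) :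
      IsRelator T (Λ.vertexLetter (Λ.init E) a * Λ.edgeLetter E *
        (Λ.edgeLetter E * Λ.vertexLetter (Λ.term E) (Λ.edgeMap E a))⁻¹)
  /-- The relations `t_E = 1` for `E` in `T`. -/
  | tree (E : Λ.E) (hE : E ∈ T) : IsRelator T (Λ.edgeLetter E)

/-- The fundamental group of a graph of groups with respect to a spanning tree `T`. -/
abbrev FundamentalGroup (T : Set Λ.E) : Type (max v e g) :=
  PresentedGroup {r | Λ.IsRelator T r}

/-- The canonical homomorphism from a vertex group to the fundamental group. -/
def ofVertex (T : Set Λ.E) (P : Λ.V) : Λ.vertexGroup P →* Λ.FundamentalGroup T :=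
  MonoidHom.mk' (fun a => PresentedGroup.mk _ (Λ.vertexLetter P a)) fun a b => by
    have h := PresentedGroup.one_of_mem (rels := {r | Λ.IsRelator T r})
      (IsRelator.vertex P a b)
    rw [map_mul, map_inv, mul_inv_eq_one, map_mul] at h
    exact h.symm

/-- A graph of groups is reduced if, for every edge that is not a loop, the edge group is not the
whole initial vertex group and its image is not the whole terminal vertex group. -/
def IsReduced : Prop :=
  ∀ E : Λ.E, Λ.init E ≠ Λ.term E → Λ.edgeGroup E ≠ ⊤ ∧ (Λ.edgeMap E).range ≠ ⊤

/-- A structure of graph of groups decomposition of the group `G` on the graph of groups `Λ`: an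
identification of the fundamental group of `Λ`, taken with some spanning tree, with `G`. -/
structure Decomposition (G : Type w) [Group G] where
  /-- The spanning tree. -/
  tree : Set Λ.E
  isSpanningTree : Λ.IsSpanningTree tree
  /-- The identification of the fundamental group with `G`. -/
  iso : Λ.FundamentalGroup tree ≃* G

namespace Decomposition

variable {Λ} {G : Type w} [Group G] (D : Λ.Decomposition G)

/-- The canonical homomorphism from a vertex group of a decomposition of `G` to `G`. -/
def vertexHom (P : Λ.V) : Λ.vertexGroup P →* G :=
  D.iso.toMonoidHom.comp (Λ.ofVertex D.tree P)

/-- A vertex group of a decomposition of `G`, as a subgroup of `G`. -/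
def vertexSubgroup (P : Λ.V) : Subgroup G :=
  (D.vertexHom P).range

/-- An edge group of a decomposition of `G`, as a subgroup of `G` (through its inclusion in the
group of the initial vertex). -/
def edgeSubgroup (E : Λ.E) : Subgroup G :=
  (Λ.edgeGroup E).map (D.vertexHom (Λ.init E))

end Decomposition

end GraphOfGroups

/-! A Coxeter group is generated by involutions, so it has no nontrivial homomorphism to the
integers. The graphs of `Λ` and `Ψ` are therefore trees and all stable letters vanish. Let `H` be
the vertex group of `V` in `Λ`, acting on the Bass–Serre tree of `Ψ`. The quotient graph of groups
decomposes `H`, with vertex groups `H ∩ rAr⁻¹` for `A` a vertex group of `Ψ`. By hypothesis `rAr⁻¹`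
lies in a conjugate of a vertex group of `Λ`, the stabilizer of a vertex `P` of the Bass–Serre tree
of `Λ`. If `P` is the base vertex, with stabilizer `H`, the intersection is all of `rAr⁻¹`, which is
case (1). Otherwise the intersection fixes two distinct vertices of a tree, hence the path between
them and its first edge, which is case (2) (`exists_le_conj_edgeSubgroup`).

The main work is the subgroup theorem `exists_decomposition_subgroup`, proved algebraically for any
tree of groups with fundamental group `G`. The quotient graph of groups is defined by double cosets,
and its fundamental group `π` maps to `H` by `toSubgroup`. In the other direction, a cocycle `F : G
→ G → π` with `F y (g * g') = F y g * F (y * g) g'` is prescribed on vertex groups and extended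
through a semidirect product (`exists_cocycle`). It is `H`-invariant in `y`, so `F 1` is a
homomorphism on `H`. Both composites with `toSubgroup` are conjugations, whence bijectivity. That
the Bass–Serre graph is a tree is then the case of the trivial subgroup. -/

/-! ### Potentials on trees and spanning trees of multigraphs. -/

namespace SimpleGraph

/-- The ordered product of a group-valued function along the darts of a walk. -/
def Walk.dartProd {V : Type*} {G : SimpleGraph V} {P : Type*} [Monoid P] (f : V → V → P) :
    ∀ {u v : V}, G.Walk u v → P
  | _, _, .nil => 1
  | u, _, .cons (v := v) _ p => f u v * p.dartProd f

theorem Walk.dartProd_concat {V : Type*} {G : SimpleGraph V} {P : Type*} [Monoid P]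
    (f : V → V → P) {u v w : V} (p : G.Walk u v) (h : G.Adj v w) :
    (p.concat h).dartProd f = p.dartProd f * f v w := by
  induction p with
  | nil => simp [Walk.concat_nil, Walk.dartProd]
  | cons h' p ih => simp [Walk.concat_cons, Walk.dartProd, ih, mul_assoc]

/-- On a tree, every antisymmetric group-valued function on darts is a coboundary. -/
theorem IsTree.exists_potential {V : Type*} {G : SimpleGraph V} (hG : G.IsTree) {P : Type*}
    [Group P] (f : V → V → P) (hf : ∀ u v, G.Adj u v → f v u = (f u v)⁻¹) :
    ∃ p : V → P, ∀ u v, G.Adj u v → p v = p u * f u v := by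
  obtain ⟨o⟩ := hG.1.nonempty
  choose π hπ _ using fun v => hG.existsUnique_path o v
  refine ⟨fun v => (π v).dartProd f, ?_⟩
  -- The potential is the product along the path from the root `o`. If that path to `u` avoids `v`,
  -- the edge extends it to the path to `v`; otherwise the path to `v` avoids `u` and the roles are
  -- exchanged.
  have key : ∀ u v (h : G.Adj u v), v ∉ (π u).support →
      (π v).dartProd f = (π u).dartProd f * f u v := by
    intro u v h hv
    have hp : ((π u).concat h).IsPath := (hπ u).concat hv h
    have := congrArg Subtype.val ((hG.2.subsingleton_path o v).elim ⟨π v, hπ v⟩ ⟨_, hp⟩)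
    rw [show π v = _ from this, Walk.dartProd_concat]
  intro u v h
  by_cases hv : v ∈ (π u).support
  · have hu := hG.2.ne_mem_support_of_support_of_adj_of_isPath (hπ u) (hπ v) h hv
    change (π v).dartProd f = (π u).dartProd f * f u v
    rw [key v u h.symm hu, hf u v h, inv_mul_cancel_right]
  · exact key u v h hv

section Multigraph

variable {V : Type v} {E : Type e} {ι τ : E → V}

theorem reachable_fromEdgeSet {S : Set (Sym2 V)} {u v : V} (h : s(u, v) ∈ S) :
    (fromEdgeSet S).Reachable u v := by
  by_cases huv : u = v
  · exact huv ▸ Reachable.refl _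
  · exact Adj.reachable ((fromEdgeSet_adj _).2 ⟨h, huv⟩)

/-- A function compatible with all edges of a connected multigraph is constant. -/
theorem eq_of_connected_fromEdgeSet {T : Set E}
    (hc : (fromEdgeSet ((fun E => s(ι E, τ E)) '' T)).Connected) {P : Type*} (f : V → P)
    (hf : ∀ E ∈ T, f (ι E) = f (τ E)) (u v : V) : f u = f v := by
  obtain ⟨p⟩ := hc.preconnected u v
  induction p with
  | nil => rfl
  | cons h p ih =>
    rw [← ih]
    obtain ⟨⟨E, hE, hs⟩, _⟩ := (fromEdgeSet_adj _).1 h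
    rcases Sym2.eq_iff.1 hs with ⟨rfl, rfl⟩ | ⟨rfl, rfl⟩
    · exact hf E hE
    · exact (hf E hE).symm

/-- On a tree of a multigraph, every group-valued function on the edges is a coboundary. -/
theorem exists_potential_of_isTree {T : Set E} (hl : ∀ E ∈ T, ι E ≠ τ E)
    (hp : ∀ E ∈ T, ∀ E' ∈ T, s(ι E, τ E) = s(ι E', τ E') → E = E')
    (ht : (fromEdgeSet ((fun E => s(ι E, τ E)) '' T)).IsTree) {P : Type*} [Group P] (f : E → P) :
    ∃ p : V → P, ∀ E ∈ T, p (τ E) = p (ι E) * f E := by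
  classical
  -- Value `f E` along `E`, its inverse against `E`, and an irrelevant default on pairs not joined
  -- by an edge of `T`. Absence of loops and parallel edges makes this consistent.
  let F : V → V → P := fun u v =>
    if h : ∃ E ∈ T, ι E = u ∧ τ E = v then f h.choose
    else if h : ∃ E ∈ T, ι E = v ∧ τ E = u then (f h.choose)⁻¹ else 1
  have h₁ : ∀ E ∈ T, F (ι E) (τ E) = f E := by
    intro E hE
    have h : ∃ E' ∈ T, ι E' = ι E ∧ τ E' = τ E := ⟨E, hE, rfl, rfl⟩
    have := h.choose_spec
    simp only [F, dif_pos h]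
    rw [hp _ this.1 E hE (by rw [this.2.1, this.2.2])]
  have h₂ : ∀ E ∈ T, F (τ E) (ι E) = (f E)⁻¹ := by
    intro E hE
    have h : ∃ E' ∈ T, ι E' = ι E ∧ τ E' = τ E := ⟨E, hE, rfl, rfl⟩
    have h' : ¬ ∃ E' ∈ T, ι E' = τ E ∧ τ E' = ι E := by
      rintro ⟨E', hE', h1, h2⟩
      have := hp E' hE' E hE (by rw [h1, h2, Sym2.eq_swap])
      subst this
      exact hl _ hE h1
    have := h.choose_spec
    simp only [F, dif_neg h', dif_pos h]
    rw [hp _ this.1 E hE (by rw [this.2.1, this.2.2])]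
  obtain ⟨p, hp⟩ := ht.exists_potential F (by
    intro u v h
    obtain ⟨⟨E, hE, hs⟩, _⟩ := (fromEdgeSet_adj _).1 h
    rcases Sym2.eq_iff.1 hs with ⟨rfl, rfl⟩ | ⟨rfl, rfl⟩
    · rw [h₁ E hE, h₂ E hE]
    · rw [h₁ E hE, h₂ E hE, inv_inv])
  refine ⟨p, fun E hE => ?_⟩
  rw [hp _ _ ((fromEdgeSet_adj _).2 ⟨⟨E, hE, rfl⟩, hl E hE⟩), h₁ E hE]

/-- A connected multigraph has a spanning tree. -/
theorem exists_spanningTree (hc : (fromEdgeSet (Set.range fun E => s(ι E, τ E))).Connected) :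
    ∃ T : Set E, (∀ E ∈ T, ι E ≠ τ E) ∧
      (∀ E ∈ T, ∀ E' ∈ T, s(ι E, τ E) = s(ι E', τ E') → E = E') ∧
      (fromEdgeSet ((fun E => s(ι E, τ E)) '' T)).IsTree := by
  obtain ⟨F, hF, hT⟩ := hc.exists_isTree_le
  have hex : ∀ x ∈ F.edgeSet, ∃ E, s(ι E, τ E) = x := fun x hx => by
    have := edgeSet_mono hF hx
    rw [edgeSet_fromEdgeSet] at this
    exact this.1
  choose k hk using hex
  refine ⟨Set.range fun x : F.edgeSet => k x x.2, ?_, ?_, ?_⟩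
  · rintro _ ⟨⟨x, hx⟩, rfl⟩ h
    have h' := hk x hx
    dsimp only at h
    rw [h] at h'
    exact F.not_isDiag_of_mem_edgeSet hx (h' ▸ rfl)
  · rintro _ ⟨⟨x, hx⟩, rfl⟩ _ ⟨⟨y, hy⟩, rfl⟩ h
    dsimp only at h
    rw [hk x hx, hk y hy] at h
    subst h
    rfl
  · have : (fun E => s(ι E, τ E)) '' (Set.range fun x : F.edgeSet => k x x.2) = F.edgeSet := by
      rw [← Set.range_comp]
      ext x
      constructor
      · rintro ⟨⟨y, hy⟩, rfl⟩
        change s(_, _) ∈ _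
        rwa [hk y hy]
      · exact fun hx => ⟨⟨x, hx⟩, hk x hx⟩
    rwa [this, fromEdgeSet_edgeSet]

end Multigraph

end SimpleGraph

/-! ### Universal properties of fundamental groups, and trees of groups. -/

namespace GraphOfGroups

variable {Λ : GraphOfGroups.{v, e, g}} {T : Set Λ.E}

/-- The stable letter of an edge, as an element of the fundamental group. -/
def ofEdge (Λ : GraphOfGroups.{v, e, g}) (T : Set Λ.E) (E : Λ.E) : Λ.FundamentalGroup T :=
  PresentedGroup.mk _ (Λ.edgeLetter E)

theorem ofEdge_eq_one {E : Λ.E} (hE : E ∈ T) : Λ.ofEdge T E = 1 :=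
  PresentedGroup.one_of_mem (rels := {r | Λ.IsRelator T r}) (IsRelator.tree E hE)

theorem ofVertex_mul_ofEdge (E : Λ.E) (a : Λ.edgeGroup E) :
    Λ.ofVertex T (Λ.init E) a * Λ.ofEdge T E =
      Λ.ofEdge T E * Λ.ofVertex T (Λ.term E) (Λ.edgeMap E a) := by
  have h := PresentedGroup.one_of_mem (rels := {r | Λ.IsRelator T r}) (IsRelator.edge E a)
  rw [map_mul, map_inv, mul_inv_eq_one, map_mul, map_mul] at h
  exact h

/-- The universal property of the fundamental group. -/
def FundamentalGroup.lift {Q : Type*} [Group Q] (f : ∀ P, Λ.vertexGroup P →* Q) (t : Λ.E → Q)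
    (h : ∀ E (a : Λ.edgeGroup E), f (Λ.init E) a * t E = t E * f (Λ.term E) (Λ.edgeMap E a))
    (ht : ∀ E ∈ T, t E = 1) : Λ.FundamentalGroup T →* Q :=
  PresentedGroup.toGroup (f := Sum.elim (fun x => f x.1 x.2) t) (by
    rintro _ (⟨P, a, b⟩ | ⟨E, a⟩ | ⟨E, hE⟩)
    · simp [vertexLetter]
    · simp [vertexLetter, edgeLetter, h]
    · simp [edgeLetter, ht E hE])

section lift

variable {Q : Type*} [Group Q] (f : ∀ P, Λ.vertexGroup P →* Q) (t : Λ.E → Q)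
    (h : ∀ E (a : Λ.edgeGroup E), f (Λ.init E) a * t E = t E * f (Λ.term E) (Λ.edgeMap E a))
    (ht : ∀ E ∈ T, t E = 1)

@[simp] theorem FundamentalGroup.lift_ofVertex (P : Λ.V) (a : Λ.vertexGroup P) :
    FundamentalGroup.lift f t h ht (Λ.ofVertex T P a) = f P a :=
  PresentedGroup.toGroup.of _

@[simp] theorem FundamentalGroup.lift_ofEdge (E : Λ.E) :
    FundamentalGroup.lift f t h ht (Λ.ofEdge T E) = t E :=
  PresentedGroup.toGroup.of _

end lift

theorem FundamentalGroup.closure_eq_top :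
    Subgroup.closure ((⋃ P, Set.range (Λ.ofVertex T P)) ∪ Set.range (Λ.ofEdge T)) = ⊤ := by
  rw [eq_top_iff, ← PresentedGroup.closure_range_of]
  refine Subgroup.closure_mono ?_
  rintro _ ⟨⟨P, a⟩ | E, rfl⟩
  · exact Or.inl (Set.mem_iUnion.2 ⟨P, a, rfl⟩)
  · exact Or.inr ⟨E, rfl⟩

theorem FundamentalGroup.hom_ext {Q : Type*} [Group Q] {φ ψ : Λ.FundamentalGroup T →* Q}
    (hv : ∀ P a, φ (Λ.ofVertex T P a) = ψ (Λ.ofVertex T P a))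
    (he : ∀ E, φ (Λ.ofEdge T E) = ψ (Λ.ofEdge T E)) : φ = ψ := by
  apply PresentedGroup.ext
  rintro (⟨P, a⟩ | E)
  · exact hv P a
  · exact he E

namespace Decomposition

variable {G : Type w} [Group G] (D : Λ.Decomposition G)

/-- If the group has no non-trivial homomorphism to the integers, then the underlying graph is a
tree. -/
theorem tree_eq_univ (h : ∀ f : G →* Multiplicative ℤ, ∀ x, f x = 1) : D.tree = Set.univ := by
  classical
  by_contra hne
  obtain ⟨E, hE⟩ := (Set.ne_univ_iff_exists_notMem _).1 hne
  -- Kill the vertex groups and count the occurrences of stable letters outside the tree; a missing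
  -- edge gives a nonzero value.
  let F : Λ.FundamentalGroup D.tree →* Multiplicative ℤ :=
    FundamentalGroup.lift (fun _ => 1) (fun E' => if E' ∈ D.tree then 1 else Multiplicative.ofAdd 1)
      (by simp) (by simp +contextual)
  have h₁ := h (F.comp D.iso.symm.toMonoidHom) (D.iso (Λ.ofEdge D.tree E))
  have h₂ : F (Λ.ofEdge D.tree E) = Multiplicative.ofAdd 1 := by simp [F, hE]
  simp [h₂] at h₁

variable {D}

theorem edgeSubgroup_le_init (E : Λ.E) : D.edgeSubgroup E ≤ D.vertexSubgroup (Λ.init E) := by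
  rintro _ ⟨a, _, rfl⟩
  exact ⟨a, rfl⟩

theorem vertexHom_edgeMap (hD : D.tree = Set.univ) (E : Λ.E) (a : Λ.edgeGroup E) :
    D.vertexHom (Λ.term E) (Λ.edgeMap E a) = D.vertexHom (Λ.init E) a := by
  have h := ofVertex_mul_ofEdge (T := D.tree) E a
  rw [ofEdge_eq_one (hD ▸ Set.mem_univ E), mul_one, one_mul] at h
  exact congrArg D.iso h.symm

theorem edgeSubgroup_le_term (hD : D.tree = Set.univ) (E : Λ.E) :
    D.edgeSubgroup E ≤ D.vertexSubgroup (Λ.term E) := by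
  rintro _ ⟨a, ha, rfl⟩
  exact ⟨Λ.edgeMap E ⟨a, ha⟩, vertexHom_edgeMap hD E ⟨a, ha⟩⟩

theorem closure_vertexSubgroup (hD : D.tree = Set.univ) :
    Subgroup.closure (⋃ P, (D.vertexSubgroup P : Set G)) = ⊤ := by
  have h := congrArg (Subgroup.map D.iso.toMonoidHom)
    (FundamentalGroup.closure_eq_top (Λ := Λ) (T := D.tree))
  rw [MonoidHom.map_closure, Subgroup.map_top_of_surjective _ D.iso.surjective] at h
  rw [eq_top_iff, ← h, Subgroup.closure_le]
  rintro _ ⟨_, hx | ⟨E, rfl⟩, rfl⟩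
  · obtain ⟨P, a, rfl⟩ := Set.mem_iUnion.1 hx
    exact Subgroup.subset_closure (Set.mem_iUnion.2 ⟨P, a, rfl⟩)
  · rw [ofEdge_eq_one (hD ▸ Set.mem_univ E)]
    simp

theorem exists_lift (hD : D.tree = Set.univ) {Q : Type*} [Group Q]
    (f : ∀ P, D.vertexSubgroup P →* Q)
    (hf : ∀ E (a : G) (ha : a ∈ D.edgeSubgroup E),
      f _ ⟨a, edgeSubgroup_le_init E ha⟩ = f _ ⟨a, edgeSubgroup_le_term hD E ha⟩) :
    ∃ F : G →* Q, ∀ P (a : D.vertexSubgroup P), F a = f P a := by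
  let F : Λ.FundamentalGroup D.tree →* Q :=
    FundamentalGroup.lift (fun P => (f P).comp (D.vertexHom P).rangeRestrict) (fun _ => 1)
      (by
        intro E a
        rw [mul_one, one_mul]
        refine (hf E (D.vertexHom _ a) (Subgroup.mem_map_of_mem _ a.2)).trans
          (congrArg (f _) (Subtype.ext ?_))
        exact (vertexHom_edgeMap hD E a).symm) (fun _ _ => rfl)
  refine ⟨F.comp D.iso.symm.toMonoidHom, ?_⟩
  rintro P ⟨_, a, rfl⟩
  change F (D.iso.symm (D.iso (Λ.ofVertex D.tree P a))) = _
  rw [MulEquiv.symm_apply_apply]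
  exact FundamentalGroup.lift_ofVertex ..

/-- Compatible cocycles on the vertex groups extend to a cocycle on the whole group. -/
theorem exists_cocycle (hD : D.tree = Set.univ) {P : Type*} [Group P] (c : Λ.V → G → G → P)
    (hc : ∀ X y, ∀ a ∈ D.vertexSubgroup X, ∀ b ∈ D.vertexSubgroup X,
      c X y (a * b) = c X y a * c X (y * a) b)
    (hE : ∀ E y, ∀ a ∈ D.edgeSubgroup E, c (Λ.init E) y a = c (Λ.term E) y a) :
    ∃ F : G → G → P, (∀ y g g', F y (g * g') = F y g * F (y * g) g') ∧
      ∀ X y, ∀ a ∈ D.vertexSubgroup X, F y a = c X y a := by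
  -- A cocycle is a homomorphism to `(G → P) ⋊ G` over the identity of `G`, where `G` translates
  -- functions on the right. This turns the extension problem into an instance of `exists_lift`.
  let σ : G →* MulAut (G → P) :=
    { toFun := fun g =>
        { toFun := fun f y => f (y * g)
          invFun := fun f y => f (y * g⁻¹)
          left_inv := fun f => by simp
          right_inv := fun f => by simp
          map_mul' := fun _ _ => rfl }
      map_one' := by ext; simp
      map_mul' := fun g g' => by
        ext f y
        exact congrArg f (mul_assoc y g g').symm }
  obtain ⟨F, hF⟩ := exists_lift hD (Q := (G → P) ⋊[σ] G)
    (fun X => MonoidHom.mk' (fun a => ⟨fun y => c X y a, a⟩) (by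
      intro a b
      refine SemidirectProduct.ext (funext fun y => ?_) rfl
      exact hc X y a a.2 b b.2))
    (fun E a ha => SemidirectProduct.ext (funext fun y => hE E y a ha) rfl)
  have hr : ∀ g, (F g).right = g := by
    have : SemidirectProduct.rightHom.comp F = MonoidHom.id G := by
      refine MonoidHom.eq_of_eqOn_dense (closure_vertexSubgroup hD) ?_
      intro x hx
      obtain ⟨X, hX⟩ := Set.mem_iUnion.1 hx
      have := hF X ⟨x, hX⟩
      simp [this]
    exact fun g => DFunLike.congr_fun this g
  refine ⟨fun y g => (F g).left y, fun y g g' => ?_, fun X y a ha => ?_⟩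
  · change (F (g * g')).left y = (F g).left y * (F g').left (y * g)
    rw [map_mul, SemidirectProduct.mul_left, hr g]
    rfl
  · have := hF X ⟨a, ha⟩
    change (F a).left y = _
    rw [show F a = _ from this]
    rfl

end Decomposition

end GraphOfGroups

/-! ### Equivariant choices in double cosets. -/

namespace DoubleCoset

variable {G : Type*} [Group G] {H A B : Subgroup G}

/-- The projection `H \ G / B → H \ G / A` for `B ≤ A`. -/
def mapOfLE (H : Subgroup G) (h : B ≤ A) :
    DoubleCoset.Quotient (H : Set G) (B : Set G) → DoubleCoset.Quotient (H : Set G) (A : Set G) :=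
  Quotient.lift (fun y => DoubleCoset.mk H A y) (fun x y hxy => by
    obtain ⟨a, ha, b, hb, rfl⟩ := rel_iff.1 hxy
    exact (DoubleCoset.eq H A _ _).2 ⟨a, ha, b, h hb, rfl⟩)

theorem mk_mul_right (y : G) {a : G} (ha : a ∈ A) :
    DoubleCoset.mk H A (y * a) = DoubleCoset.mk H A y :=
  ((DoubleCoset.eq H A _ _).2 ⟨1, H.one_mem, a, ha, by group⟩).symm

theorem mk_mul_left (y : G) {h : G} (hh : h ∈ H) :
    DoubleCoset.mk H A (h * y) = DoubleCoset.mk H A y :=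
  ((DoubleCoset.eq H A _ _).2 ⟨h, hh, 1, A.one_mem, by group⟩).symm

/-- For a system `r` of representatives of the double cosets, elements `k y` of `H` with
`y ∈ k y • r • A` may be chosen `H`-equivariantly. -/
theorem exists_equivariant (r : DoubleCoset.Quotient (H : Set G) (A : Set G) → G)
    (hr : ∀ d, DoubleCoset.mk H A (r d) = d) :
    ∃ k : G → H, (∀ (h : H) y, k (h * y) = h * k y) ∧
      ∀ y, (r (DoubleCoset.mk H A y))⁻¹ * (k y : G)⁻¹ * y ∈ A := by
  have hex : ∀ y, ∃ k : H, (r (DoubleCoset.mk H A y))⁻¹ * (k : G)⁻¹ * y ∈ A := by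
    intro y
    have hz := hr (DoubleCoset.mk H A y)
    generalize r (DoubleCoset.mk H A y) = z at hz
    obtain ⟨h, hh, a, ha, hy⟩ := (DoubleCoset.eq H A _ _).1 hz
    refine ⟨⟨h, hh⟩, ?_⟩
    convert ha
    rw [hy]
    group
  choose k₀ hk₀ using hex
  -- Choose freely only at one representative `s y` of each coset `Hy`, then transport by the
  -- element `y * (s y)⁻¹` of `H`.
  let s : G → G := fun y => (Quotient.mk (QuotientGroup.rightRel H) y).out
  have hs : ∀ y, y * (s y)⁻¹ ∈ H := fun y =>
    QuotientGroup.rightRel_apply.1 (Quotient.mk_out (s := QuotientGroup.rightRel H) y)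
  have hsh : ∀ (h : H) y, s (h * y) = s y := by
    intro h y
    refine congrArg Quotient.out (Quotient.sound (QuotientGroup.rightRel_apply.2 ?_))
    simp
  refine ⟨fun y => ⟨_, hs y⟩ * k₀ (s y), fun h y => ?_, fun y => ?_⟩
  · ext
    simp [hsh, mul_assoc]
  · have h1 := hk₀ (s y)
    have h2 : DoubleCoset.mk H A (s y) = DoubleCoset.mk H A y := by
      conv_rhs => rw [show y = y * (s y)⁻¹ * s y by group]
      rw [mk_mul_left _ (hs y)]
    rw [h2] at h1
    convert h1 using 1
    simp [mul_assoc]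

end DoubleCoset

/-! ### The quotient of the Bass–Serre graph by a subgroup, and its transversals. -/

namespace GraphOfGroups.Decomposition

variable {Λ : GraphOfGroups.{v, e, g}} {G : Type w} [Group G] (D : Λ.Decomposition G)
  (H : Subgroup G)

/-- The vertices of the quotient by `H` of the Bass–Serre graph of a decomposition. -/
abbrev CosetVertex : Type (max v w) :=
  Σ X : Λ.V, DoubleCoset.Quotient (H : Set G) (D.vertexSubgroup X : Set G)

/-- The edges of the quotient by `H` of the Bass–Serre graph of a decomposition. -/
abbrev CosetEdge : Type (max e w) :=
  Σ E : Λ.E, DoubleCoset.Quotient (H : Set G) (D.edgeSubgroup E : Set G)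

variable {D}

/-- The initial vertex in the quotient of the Bass–Serre graph. -/
def cosetInit (ε : D.CosetEdge H) : D.CosetVertex H :=
  ⟨Λ.init ε.1, DoubleCoset.mapOfLE H (edgeSubgroup_le_init ε.1) ε.2⟩

/-- The terminal vertex in the quotient of the Bass–Serre graph. -/
def cosetTerm (hD : D.tree = Set.univ) (ε : D.CosetEdge H) : D.CosetVertex H :=
  ⟨Λ.term ε.1, DoubleCoset.mapOfLE H (edgeSubgroup_le_term hD ε.1) ε.2⟩

variable (D) in
/-- The vertex of the quotient graph represented by a vertex of `Λ` and a group element. -/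
def cosetVertex (X : Λ.V) (y : G) : D.CosetVertex H := ⟨X, DoubleCoset.mk H _ y⟩

variable (D) in
/-- The edge of the quotient graph represented by an edge of `Λ` and a group element. -/
def cosetEdge (E : Λ.E) (y : G) : D.CosetEdge H := ⟨E, DoubleCoset.mk H _ y⟩

variable {H}

theorem cosetVertex_mul_right {X : Λ.V} (y : G) {a : G} (ha : a ∈ D.vertexSubgroup X) :
    D.cosetVertex H X (y * a) = D.cosetVertex H X y := by
  rw [cosetVertex, DoubleCoset.mk_mul_right _ ha, cosetVertex]

theorem cosetVertex_mul_left {X : Λ.V} (y : G) {h : G} (hh : h ∈ H) :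
    D.cosetVertex H X (h * y) = D.cosetVertex H X y := by
  rw [cosetVertex, DoubleCoset.mk_mul_left _ hh, cosetVertex]

theorem cosetEdge_mul_right {E : Λ.E} (y : G) {a : G} (ha : a ∈ D.edgeSubgroup E) :
    D.cosetEdge H E (y * a) = D.cosetEdge H E y := by
  rw [cosetEdge, DoubleCoset.mk_mul_right _ ha, cosetEdge]

theorem cosetEdge_mul_left {E : Λ.E} (y : G) {h : G} (hh : h ∈ H) :
    D.cosetEdge H E (h * y) = D.cosetEdge H E y := by
  rw [cosetEdge, DoubleCoset.mk_mul_left _ hh, cosetEdge]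

theorem exists_cosetVertex_eq (v : D.CosetVertex H) : ∃ y, D.cosetVertex H v.1 y = v :=
  ⟨Quotient.out v.2, Sigma.ext rfl (heq_of_eq (Quotient.out_eq v.2))⟩

theorem exists_cosetEdge_eq (ε : D.CosetEdge H) : ∃ y, D.cosetEdge H ε.1 y = ε :=
  ⟨Quotient.out ε.2, Sigma.ext rfl (heq_of_eq (Quotient.out_eq ε.2))⟩

theorem cosetVertex_eq_iff {X : Λ.V} {y z : G} :
    D.cosetVertex H X y = D.cosetVertex H X z ↔
      ∃ h ∈ H, ∃ a ∈ D.vertexSubgroup X, z = h * y * a := by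
  rw [← DoubleCoset.eq H (D.vertexSubgroup X) y z]
  exact ⟨fun h => eq_of_heq (Sigma.mk.inj h).2, fun h => Sigma.ext rfl (heq_of_eq h)⟩

theorem cosetEdge_eq_iff {E : Λ.E} {y z : G} :
    D.cosetEdge H E y = D.cosetEdge H E z ↔
      ∃ h ∈ H, ∃ a ∈ D.edgeSubgroup E, z = h * y * a := by
  rw [← DoubleCoset.eq H (D.edgeSubgroup E) y z]
  exact ⟨fun h => eq_of_heq (Sigma.mk.inj h).2, fun h => Sigma.ext rfl (heq_of_eq h)⟩

@[simp] theorem cosetInit_cosetEdge (E : Λ.E) (y : G) :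
    cosetInit H (D.cosetEdge H E y) = D.cosetVertex H (Λ.init E) y := rfl

@[simp] theorem cosetTerm_cosetEdge (hD : D.tree = Set.univ) (E : Λ.E) (y : G) :
    cosetTerm H hD (D.cosetEdge H E y) = D.cosetVertex H (Λ.term E) y := rfl

variable (H) in
theorem connected_cosetGraph (hD : D.tree = Set.univ) :
    (SimpleGraph.fromEdgeSet
      (Set.range fun ε : D.CosetEdge H => s(cosetInit H ε, cosetTerm H hD ε))).Connected := by
  set K := SimpleGraph.fromEdgeSet
      (Set.range fun ε : D.CosetEdge H => s(cosetInit H ε, cosetTerm H hD ε))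
  have hedge : ∀ E y, K.Reachable (D.cosetVertex H (Λ.init E) y) (D.cosetVertex H (Λ.term E) y) :=
    fun E y => SimpleGraph.reachable_fromEdgeSet ⟨D.cosetEdge H E y, rfl⟩
  have hbase : ∀ X Y y, K.Reachable (D.cosetVertex H X y) (D.cosetVertex H Y y) := by
    intro X Y y
    have hc := Λ.connected
    rw [← Set.image_univ] at hc
    have := SimpleGraph.eq_of_connected_fromEdgeSet hc
      (fun Z => K.connectedComponentMk (D.cosetVertex H Z y))
      (fun E _ => SimpleGraph.ConnectedComponent.sound (hedge E y)) X Y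
    exact SimpleGraph.ConnectedComponent.exact this
  obtain ⟨X₀⟩ := Λ.connected.nonempty
  -- Quantifying over all `y` makes this set a subgroup. It contains every vertex group, since `y`
  -- and `y * a` represent the same vertex when `a` lies in the vertex group, so it is everything.
  let N : Subgroup G :=
    { carrier := {g | ∀ y, K.Reachable (D.cosetVertex H X₀ y) (D.cosetVertex H X₀ (y * g))}
      one_mem' := fun y => by rw [mul_one]
      mul_mem' := fun {a b} ha hb y => (ha y).trans (mul_assoc y a b ▸ hb (y * a))
      inv_mem' := fun {a} ha y => by
        have := ha (y * a⁻¹)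
        rw [inv_mul_cancel_right] at this
        exact this.symm }
  have hN : N = ⊤ := by
    rw [eq_top_iff, ← closure_vertexSubgroup hD, Subgroup.closure_le]
    intro a ha y
    obtain ⟨X, ha⟩ := Set.mem_iUnion.1 ha
    have h := hbase X₀ X y
    rw [← cosetVertex_mul_right y ha] at h
    exact h.trans (hbase _ _ _)
  have hall : ∀ v, K.Reachable (D.cosetVertex H X₀ 1) v := by
    intro v
    obtain ⟨y, hy⟩ := exists_cosetVertex_eq v
    rw [← hy]
    have : y ∈ N := hN ▸ Subgroup.mem_top y
    have h := this 1
    rw [one_mul] at h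
    exact h.trans (hbase _ _ _)
  exact { preconnected := fun u v => (hall u).symm.trans (hall v)
          nonempty := ⟨D.cosetVertex H X₀ 1⟩ }

/-- Representatives for the orbits of `H` on the Bass–Serre graph of a decomposition. -/
structure Transversal (hD : D.tree = Set.univ) (H : Subgroup G) where
  /-- The representatives of the orbits of vertices. -/
  vertexRep : D.CosetVertex H → G
  cosetVertex_vertexRep : ∀ v, D.cosetVertex H v.1 (vertexRep v) = v
  /-- The representatives of the orbits of edges. -/
  edgeRep : D.CosetEdge H → G
  cosetEdge_edgeRep : ∀ ε, D.cosetEdge H ε.1 (edgeRep ε) = ε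
  /-- The element of `H` that moves a vertex representative to the terminal vertex of an edge
  representative. -/
  shift : D.CosetEdge H → H
  init_mem : ∀ ε, (vertexRep (cosetInit H ε))⁻¹ * edgeRep ε ∈ D.vertexSubgroup (Λ.init ε.1)
  term_mem : ∀ ε, (vertexRep (cosetTerm H hD ε))⁻¹ * (shift ε : G)⁻¹ * edgeRep ε ∈
    D.vertexSubgroup (Λ.term ε.1)

/-- There are orbit representatives which lift a given spanning tree. -/
theorem exists_transversal (hD : D.tree = Set.univ) {T : Set (D.CosetEdge H)}
    (hl : ∀ ε ∈ T, cosetInit H ε ≠ cosetTerm H hD ε)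
    (hp : ∀ ε ∈ T, ∀ ε' ∈ T,
      s(cosetInit H ε, cosetTerm H hD ε) = s(cosetInit H ε', cosetTerm H hD ε') → ε = ε')
    (ht : (SimpleGraph.fromEdgeSet
      ((fun ε => s(cosetInit H ε, cosetTerm H hD ε)) '' T)).IsTree) :
    ∃ S : Transversal hD H, ∀ ε ∈ T, S.shift ε = 1 := by
  choose r hr using exists_cosetVertex_eq (D := D) (H := H)
  have hq : ∀ ε : D.CosetEdge H, ∃ q, D.cosetEdge H ε.1 q = ε ∧
      (r (cosetInit H ε))⁻¹ * q ∈ D.vertexSubgroup (Λ.init ε.1) := by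
    intro ε
    obtain ⟨y, hy⟩ := exists_cosetEdge_eq ε
    obtain ⟨h, hh, a, ha, he⟩ := cosetVertex_eq_iff.1
      ((hr (cosetInit H ε)).trans (congrArg (cosetInit H) hy.symm))
    refine ⟨h⁻¹ * y, by rw [cosetEdge_mul_left _ (H.inv_mem hh), hy], ?_⟩
    change a ∈ D.vertexSubgroup (Λ.init ε.1) at ha
    convert ha
    rw [he]
    group
  choose q hq hqi using hq
  have hs : ∀ ε : D.CosetEdge H, ∃ h : H, (r (cosetTerm H hD ε))⁻¹ * (h : G)⁻¹ * q ε ∈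
      D.vertexSubgroup (Λ.term ε.1) := by
    intro ε
    obtain ⟨h, hh, a, ha, he⟩ := cosetVertex_eq_iff.1
      ((hr (cosetTerm H hD ε)).trans (congrArg (cosetTerm H hD) (hq ε).symm))
    refine ⟨⟨h, hh⟩, ?_⟩
    change a ∈ D.vertexSubgroup (Λ.term ε.1) at ha
    convert ha
    rw [he]
    group
  choose h hh using hs
  -- Translating the representatives by `p` changes the shift `h ε` to `p (init) * h ε * p
  -- (term)⁻¹`, which is trivial on the tree.
  obtain ⟨p, hp⟩ := SimpleGraph.exists_potential_of_isTree hl hp ht h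
  refine ⟨⟨fun v => p v * r v, fun v => ?_, fun ε => p (cosetInit H ε) * q ε, fun ε => ?_,
    fun ε => p (cosetInit H ε) * h ε * (p (cosetTerm H hD ε))⁻¹, fun ε => ?_, fun ε => ?_⟩, ?_⟩
  · rw [cosetVertex_mul_left _ (p v).2, hr]
  · rw [cosetEdge_mul_left _ (p _).2, hq]
  · convert hqi ε using 1
    group
  · convert hh ε using 1
    push_cast
    group
  · intro ε hε
    simp only
    rw [hp ε hε, mul_inv_cancel]

end GraphOfGroups.Decomposition

/-! ### The quotient graph of groups and the cocycle with values in its fundamental group. -/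

namespace GraphOfGroups.Decomposition.Transversal

variable {Λ : GraphOfGroups.{v, e, g}} {G : Type w} [Group G] {D : Λ.Decomposition G}
  {hD : D.tree = Set.univ} {H : Subgroup G} (S : Transversal hD H)

/-- The stabilizer in `H` of a vertex representative. -/
def vertexStab (v : D.CosetVertex H) : Subgroup H :=
  (D.vertexSubgroup v.1).comap ((MulAut.conj (S.vertexRep v)⁻¹).toMonoidHom.comp H.subtype)

/-- The stabilizer in `H` of an edge representative. -/
def edgeStab (ε : D.CosetEdge H) : Subgroup H :=
  (D.edgeSubgroup ε.1).comap ((MulAut.conj (S.edgeRep ε)⁻¹).toMonoidHom.comp H.subtype)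

variable {S} in
theorem mem_vertexStab {v : D.CosetVertex H} {x : H} :
    x ∈ S.vertexStab v ↔ (S.vertexRep v)⁻¹ * x * S.vertexRep v ∈ D.vertexSubgroup v.1 := by
  simp [vertexStab]

variable {S} in
theorem mem_edgeStab {ε : D.CosetEdge H} {x : H} :
    x ∈ S.edgeStab ε ↔ (S.edgeRep ε)⁻¹ * x * S.edgeRep ε ∈ D.edgeSubgroup ε.1 := by
  simp [edgeStab]

/-- `S.Carries v x y`: the element `x` of `H` carries the representative of `v` to the vertex
`y • D.vertexSubgroup v.1` of the Bass–Serre graph. -/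
def Carries (v : D.CosetVertex H) (x : H) (y : G) : Prop :=
  (S.vertexRep v)⁻¹ * (x : G)⁻¹ * y ∈ D.vertexSubgroup v.1

variable {S}

theorem Carries.mul_right {v : D.CosetVertex H} {x : H} {y : G} (h : S.Carries v x y) {a : G}
    (ha : a ∈ D.vertexSubgroup v.1) : S.Carries v x (y * a) := by
  have := mul_mem h ha
  rwa [mul_assoc] at this

theorem Carries.mem {v : D.CosetVertex H} {x z : H} {y : G} (hx : S.Carries v x y)
    (hz : S.Carries v z y) : x⁻¹ * z ∈ S.vertexStab v := by
  rw [mem_vertexStab]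
  convert mul_mem hx (inv_mem hz) using 1
  push_cast
  group

theorem carries_init {ε : D.CosetEdge H} {x : H} {y : G}
    (h : (S.edgeRep ε)⁻¹ * (x : G)⁻¹ * y ∈ D.edgeSubgroup ε.1) : S.Carries (cosetInit H ε) x y := by
  have := mul_mem (S.init_mem ε) (edgeSubgroup_le_init _ h)
  change _ ∈ D.vertexSubgroup (Λ.init ε.1)
  convert this using 1
  group

theorem carries_term {ε : D.CosetEdge H} {x : H} {y : G}
    (h : (S.edgeRep ε)⁻¹ * (x : G)⁻¹ * y ∈ D.edgeSubgroup ε.1) :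
    S.Carries (cosetTerm H hD ε) (x * S.shift ε) y := by
  have := mul_mem (S.term_mem ε) (edgeSubgroup_le_term hD _ h)
  change _ ∈ D.vertexSubgroup (Λ.term ε.1)
  convert this using 1
  push_cast
  group

theorem edgeStab_le (ε : D.CosetEdge H) : S.edgeStab ε ≤ S.vertexStab (cosetInit H ε) := by
  intro x hx
  have h1 : S.Carries (cosetInit H ε) x⁻¹ (S.edgeRep ε) :=
    carries_init (by simpa using mem_edgeStab.1 hx)
  have h2 : S.Carries (cosetInit H ε) 1 (S.edgeRep ε) := carries_init (by simp)
  simpa using h1.mem h2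

theorem conj_shift_mem {ε : D.CosetEdge H} {x : H} (hx : x ∈ S.edgeStab ε) :
    (S.shift ε)⁻¹ * x * S.shift ε ∈ S.vertexStab (cosetTerm H hD ε) := by
  have h1 : S.Carries (cosetTerm H hD ε) (x⁻¹ * S.shift ε) (S.edgeRep ε) :=
    carries_term (by simpa using mem_edgeStab.1 hx)
  have h2 : S.Carries (cosetTerm H hD ε) (1 * S.shift ε) (S.edgeRep ε) := carries_term (by simp)
  simpa using h1.mem h2

variable (S)

/-- The quotient graph of groups of the action of a subgroup on the Bass–Serre graph of a
decomposition. -/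
@[reducible] def graph : GraphOfGroups.{max v w, max e w, w} where
  V := D.CosetVertex H
  E := D.CosetEdge H
  init := cosetInit H
  term := cosetTerm H hD
  connected := connected_cosetGraph H hD
  vertexGroup v := S.vertexStab v
  edgeGroup ε := (S.edgeStab ε).subgroupOf (S.vertexStab (cosetInit H ε))
  edgeMap ε := MonoidHom.mk' (fun x => ⟨(S.shift ε)⁻¹ * x * S.shift ε, conj_shift_mem x.2⟩)
    (fun x y => by ext; simp [mul_assoc])
  edgeMap_injective ε := fun x y hxy => by
    have := congrArg Subtype.val hxy
    simpa using this

variable (T : Set (D.CosetEdge H))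

open Classical in
/-- An element of the stabilizer of a vertex representative, as an element of the fundamental group
of the quotient graph of groups. -/
noncomputable def letter (v : D.CosetVertex H) (x : H) : S.graph.FundamentalGroup T :=
  if hx : x ∈ S.vertexStab v then S.graph.ofVertex T v ⟨x, hx⟩ else 1

/-- The stable letter of an edge of the quotient graph of groups. -/
def stable (ε : D.CosetEdge H) : S.graph.FundamentalGroup T := S.graph.ofEdge T ε

variable {S T}

theorem letter_of_mem {v : D.CosetVertex H} {x : H} (hx : x ∈ S.vertexStab v) :
    S.letter T v x = S.graph.ofVertex T v ⟨x, hx⟩ := dif_pos hx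

theorem letter_one (v : D.CosetVertex H) : S.letter T v 1 = 1 := by
  rw [letter_of_mem (one_mem _)]
  exact map_one _

theorem letter_mul {v : D.CosetVertex H} {x y : H} (hx : x ∈ S.vertexStab v)
    (hy : y ∈ S.vertexStab v) : S.letter T v (x * y) = S.letter T v x * S.letter T v y := by
  rw [letter_of_mem hx, letter_of_mem hy, letter_of_mem (mul_mem hx hy), ← map_mul]
  rfl

theorem letter_mul_stable {ε : D.CosetEdge H} {x : H} (hx : x ∈ S.edgeStab ε) :
    S.letter T (cosetInit H ε) x * S.stable T ε =
      S.stable T ε * S.letter T (cosetTerm H hD ε) ((S.shift ε)⁻¹ * x * S.shift ε) := by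
  rw [letter_of_mem (edgeStab_le ε hx), letter_of_mem (conj_shift_mem hx)]
  exact ofVertex_mul_ofEdge (Λ := S.graph) ε ⟨⟨x, edgeStab_le ε hx⟩, hx⟩

/-- Two elements carrying the representative to the same vertex differ by its stabilizer, so letters
of the form `x⁻¹ * y` compose as in a groupoid and never take the default value of `letter`. -/
theorem Carries.letter_mul_letter {v : D.CosetVertex H} {x y z : H} {g : G}
    (hx : S.Carries v x g) (hy : S.Carries v y g) (hz : S.Carries v z g) :
    S.letter T v (x⁻¹ * y) * S.letter T v (y⁻¹ * z) = S.letter T v (x⁻¹ * z) := by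
  rw [← letter_mul (hx.mem hy) (hy.mem hz)]
  group

theorem Carries.inv_letter {v : D.CosetVertex H} {x y : H} {g : G}
    (hx : S.Carries v x g) (hy : S.Carries v y g) :
    (S.letter T v (x⁻¹ * y))⁻¹ = S.letter T v (y⁻¹ * x) := by
  rw [inv_eq_iff_mul_eq_one, hx.letter_mul_letter hy hx, inv_mul_cancel, letter_one]

/-- The canonical homomorphism from the fundamental group of the quotient graph of groups. -/
def toSubgroup (hT : ∀ ε ∈ T, S.shift ε = 1) : S.graph.FundamentalGroup T →* H :=
  FundamentalGroup.lift (Λ := S.graph) (fun v => (S.vertexStab v).subtype) S.shift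
    (fun ε a => by
      change (a : H) * _ = _ * (_ * (a : H) * _)
      group) hT

section

variable (hT : ∀ ε ∈ T, S.shift ε = 1)

theorem toSubgroup_letter {v : D.CosetVertex H} {x : H} (hx : x ∈ S.vertexStab v) :
    toSubgroup hT (S.letter T v x) = x := by
  rw [letter_of_mem hx]
  exact FundamentalGroup.lift_ofVertex ..

theorem toSubgroup_stable (ε : D.CosetEdge H) : toSubgroup hT (S.stable T ε) = S.shift ε :=
  FundamentalGroup.lift_ofEdge ..

end

theorem stable_eq_one {ε : D.CosetEdge H} (hε : ε ∈ T) : S.stable T ε = 1 :=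
  ofEdge_eq_one (Λ := S.graph) hε

variable (S T) in
/-- A cocycle on the whole group with values in the fundamental group of the quotient graph of
groups, which restricts to a homomorphism on `H`. -/
structure CosetCocycle (hΛ : Λ.IsSpanningTree Set.univ) where
  k : Λ.V → G → H
  l : Λ.E → G → H
  b : Λ.V → G → S.graph.FundamentalGroup T
  F : G → G → S.graph.FundamentalGroup T
  k_mul : ∀ X (h : H) y, k X (h * y) = h * k X y
  b_mul : ∀ X (h : H) y, b X (h * y) = b X y
  carries_k : ∀ X y, S.Carries (D.cosetVertex H X y) (k X y) y
  l_mem : ∀ E y, (S.edgeRep (D.cosetEdge H E y))⁻¹ * (l E y : G)⁻¹ * y ∈ D.edgeSubgroup E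
  b_term : ∀ E y, b (Λ.term E) y = b (Λ.init E) y *
    (S.letter T (D.cosetVertex H (Λ.init E) y) ((k (Λ.init E) y)⁻¹ * l E y) *
      S.stable T (D.cosetEdge H E y) *
      S.letter T (D.cosetVertex H (Λ.term E) y)
        ((l E y * S.shift (D.cosetEdge H E y))⁻¹ * k (Λ.term E) y))
  F_mul : ∀ y g g', F y (g * g') = F y g * F (y * g) g'
  F_eq : ∀ X y, ∀ a ∈ D.vertexSubgroup X, F y a =
    b X y * S.letter T (D.cosetVertex H X y) ((k X y)⁻¹ * k X (y * a)) * (b X (y * a))⁻¹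

theorem transport_identity {P : Type*} [Group P] {p p' A A' R U t B B' M N : P}
    (hu : A * R = U * A') (ht : R * t = t * N) (hw : B * M = N * B') :
    p * U * p'⁻¹ = p * (A * t * B) * M * (p' * (A' * t * B'))⁻¹ := by
  rw [← eq_mul_inv_iff_mul_eq] at hu ht hw
  rw [hw, hu, ht]
  group

/-- The elements `k X y` and `l E y` carry the representatives to the vertex and the edge given by
`y`. Along an edge, the comparison of the two vertex carriers passes through `l` and the stable
letter. As `Λ` is a tree, for each `y` these comparisons have a potential `b`. Correcting by `b`
makes the prescriptions on adjacent vertex groups agree on edge groups, so they glue. -/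
theorem nonempty_cosetCocycle (hΛ : Λ.IsSpanningTree Set.univ) :
    Nonempty (CosetCocycle S T hΛ) := by
  have hr : ∀ X d, DoubleCoset.mk H (D.vertexSubgroup X) (S.vertexRep ⟨X, d⟩) = d := fun X d =>
    eq_of_heq (Sigma.mk.inj (S.cosetVertex_vertexRep ⟨X, d⟩)).2
  have hq : ∀ E d, DoubleCoset.mk H (D.edgeSubgroup E) (S.edgeRep ⟨E, d⟩) = d := fun E d =>
    eq_of_heq (Sigma.mk.inj (S.cosetEdge_edgeRep ⟨E, d⟩)).2
  choose k hk hkm using fun X => DoubleCoset.exists_equivariant _ (hr X)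
  choose l hl hlm using fun E => DoubleCoset.exists_equivariant _ (hq E)
  -- The potential is chosen as a function of the edge data `f` alone, so it inherits the
  -- `H`-invariance of `f y` proved in `hf`.
  choose p hp using fun f : Λ.E → S.graph.FundamentalGroup T =>
    SimpleGraph.exists_potential_of_isTree hΛ.not_loop hΛ.not_parallel hΛ.isTree f
  let f : G → Λ.E → S.graph.FundamentalGroup T := fun y E =>
    S.letter T (D.cosetVertex H (Λ.init E) y) ((k (Λ.init E) y)⁻¹ * l E y) *
      S.stable T (D.cosetEdge H E y) *
      S.letter T (D.cosetVertex H (Λ.term E) y)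
        ((l E y * S.shift (D.cosetEdge H E y))⁻¹ * k (Λ.term E) y)
  have hf : ∀ (h : H) y, f (h * y) = f y := by
    intro h y
    funext E
    simp only [f, hk, hl, cosetVertex_mul_left _ h.2, cosetEdge_mul_left _ h.2, mul_inv_rev,
      mul_assoc, inv_mul_cancel_left]
  have hck : ∀ X y, S.Carries (D.cosetVertex H X y) (k X y) y := hkm
  have hbt : ∀ E y, p (f y) (Λ.term E) = p (f y) (Λ.init E) * f y E :=
    fun E y => hp (f y) E (Set.mem_univ E)
  have hcka : ∀ X y, ∀ a ∈ D.vertexSubgroup X,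
      S.Carries (D.cosetVertex H X y) (k X (y * a)) y := by
    intro X y a ha
    have := (hck X (y * a)).mul_right (inv_mem ha)
    rwa [cosetVertex_mul_right y ha, mul_inv_cancel_right] at this
  obtain ⟨F, hF, hFv⟩ := exists_cocycle hD (fun X y a => p (f y) X *
    S.letter T (D.cosetVertex H X y) ((k X y)⁻¹ * k X (y * a)) * (p (f (y * a)) X)⁻¹)
    (by
      intro X y a ha c hc
      have h1 := hcka X y a ha
      have h2 := hcka X y _ (mul_mem ha hc)
      rw [cosetVertex_mul_right y ha, ← (hck X y).letter_mul_letter h1 h2, mul_assoc y a c]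
      group)
    (by
      intro E y a ha
      have hai := edgeSubgroup_le_init E ha
      have hat := edgeSubgroup_le_term hD E ha
      have hli : S.Carries (D.cosetVertex H (Λ.init E) y) (l E y) y :=
        carries_init (ε := D.cosetEdge H E y) (hlm E y)
      have hlt : S.Carries (D.cosetVertex H (Λ.term E) y)
          (l E y * S.shift (D.cosetEdge H E y)) y :=
        carries_term (ε := D.cosetEdge H E y) (hlm E y)
      have hla : (S.edgeRep (D.cosetEdge H E y))⁻¹ * (l E (y * a) : G)⁻¹ * y ∈
          D.edgeSubgroup E := by
        have := mul_mem (hlm E (y * a)) (inv_mem ha)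
        change (S.edgeRep (D.cosetEdge H E (y * a)))⁻¹ * _ * _ * _ ∈ _ at this
        rw [cosetEdge_mul_right y ha] at this
        convert this using 1
        group
      have hlai : S.Carries (D.cosetVertex H (Λ.init E) y) (l E (y * a)) y :=
        carries_init (ε := D.cosetEdge H E y) hla
      have hlat : S.Carries (D.cosetVertex H (Λ.term E) y)
          (l E (y * a) * S.shift (D.cosetEdge H E y)) y :=
        carries_term (ε := D.cosetEdge H E y) hla
      have hst : (l E y)⁻¹ * l E (y * a) ∈ S.edgeStab (D.cosetEdge H E y) := by
        rw [mem_edgeStab]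
        have hm := mul_mem (hlm E y) (inv_mem hla)
        change (S.edgeRep (D.cosetEdge H E y))⁻¹ * _ * _ * _ ∈ D.edgeSubgroup E at hm
        change _ ∈ D.edgeSubgroup E
        convert hm using 1
        push_cast
        group
      have hrel := letter_mul_stable (T := T) hst
      simp only [cosetInit_cosetEdge, cosetTerm_cosetEdge] at hrel
      have hki := hck (Λ.init E) y
      have hkt := hck (Λ.term E) y
      have hkai := hcka _ y a hai
      have hkat := hcka _ y a hat
      rw [hbt E y, hbt E (y * a)]
      simp only [f, cosetVertex_mul_right y hai, cosetVertex_mul_right y hat,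
        cosetEdge_mul_right y ha]
      have hu := (hki.letter_mul_letter (T := T) hli hlai).trans
        (hki.letter_mul_letter hkai hlai).symm
      have hw := (hlt.letter_mul_letter (T := T) hkt hkat).trans
        (hlt.letter_mul_letter hlat hkat).symm
      rw [show (S.shift (D.cosetEdge H E y))⁻¹ * ((l E y)⁻¹ * l E (y * a)) *
        S.shift (D.cosetEdge H E y) = (l E y * S.shift (D.cosetEdge H E y))⁻¹ *
        (l E (y * a) * S.shift (D.cosetEdge H E y)) by group] at hrel
      -- `hu` and `hw` are groupoid relations at the two ends of the edge; `hrel` moves an edge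
      -- stabilizer element across the stable letter.
      exact transport_identity hu hrel hw)
  exact ⟨⟨k, l, fun X y => p (f y) X, F, hk, fun X h y => by rw [hf], hck, hlm, hbt, hF, hFv⟩⟩

end GraphOfGroups.Decomposition.Transversal

/-! ### The cocycle inverts the canonical homomorphism up to conjugation. -/

namespace GraphOfGroups.Decomposition.Transversal

variable {Λ : GraphOfGroups.{v, e, g}} {G : Type w} [Group G] {D : Λ.Decomposition G}
  {hD : D.tree = Set.univ} {H : Subgroup G} {S : Transversal hD H} {T : Set (D.CosetEdge H)}

namespace CosetCocycle

variable {hΛ : Λ.IsSpanningTree Set.univ} (c : CosetCocycle S T hΛ)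

theorem F_one (y : G) : c.F y 1 = 1 := by
  have := c.F_mul y 1 1
  rwa [mul_one, mul_one, left_eq_mul] at this

/-- On a vertex group the formula for `F` involves `k` only through quotients `k⁻¹ * k'`, which do
not change under left multiplication by `H`; the cocycle rule propagates this to all of `G`. -/
theorem F_left_mul (h : H) (y g : G) : c.F (h * y) g = c.F y g := by
  let N : Subgroup G :=
    { carrier := {g | ∀ y, c.F (h * y) g = c.F y g}
      one_mem' := fun y => by rw [F_one, F_one]
      mul_mem' := fun {a b} ha hb y => by
        rw [c.F_mul, c.F_mul, ha y, mul_assoc, hb]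
      inv_mem' := fun {a} ha y => by
        have h1 := c.F_mul (h * y) a⁻¹ a
        have h2 := c.F_mul y a⁻¹ a
        rw [inv_mul_cancel, F_one] at h1 h2
        rw [mul_assoc, ha] at h1
        exact mul_right_cancel (h1.symm.trans h2) }
  have hN : N = ⊤ := by
    rw [eq_top_iff, ← closure_vertexSubgroup hD, Subgroup.closure_le]
    intro a ha y
    obtain ⟨X, ha⟩ := Set.mem_iUnion.1 ha
    rw [c.F_eq X _ a ha, c.F_eq X _ a ha, mul_assoc (h : G), c.b_mul, c.b_mul, c.k_mul,
      c.k_mul, cosetVertex_mul_left _ h.2, mul_inv_rev, mul_assoc _ _ (_ * _), inv_mul_cancel_left]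
  exact (hN ▸ Subgroup.mem_top g : g ∈ N) y

/-- The restriction of the cocycle to `H`. -/
def hom : H →* S.graph.FundamentalGroup T :=
  MonoidHom.mk' (fun h => c.F 1 h) (fun a b => by
    have := c.F_left_mul a 1 b
    rw [mul_one] at this
    rw [Subgroup.coe_mul, c.F_mul, one_mul, this])

theorem hom_apply (h : H) : c.hom h = c.F 1 h := rfl

theorem carries_k_mul {X : Λ.V} (y : G) {a : G} (ha : a ∈ D.vertexSubgroup X) :
    S.Carries (D.cosetVertex H X y) (c.k X (y * a)) y := by
  have := (c.carries_k X (y * a)).mul_right (inv_mem ha)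
  rwa [cosetVertex_mul_right y ha, mul_inv_cancel_right] at this

theorem carries_init_l (E : Λ.E) (y : G) :
    S.Carries (D.cosetVertex H (Λ.init E) y) (c.l E y) y :=
  carries_init (ε := D.cosetEdge H E y) (c.l_mem E y)

theorem carries_term_l (E : Λ.E) (y : G) :
    S.Carries (D.cosetVertex H (Λ.term E) y) (c.l E y * S.shift (D.cosetEdge H E y)) y :=
  carries_term (ε := D.cosetEdge H E y) (c.l_mem E y)

/-- The comparison between the cocycle and the trivial cocycle of `H`. -/
def gauge (hT : ∀ ε ∈ T, S.shift ε = 1) (X : Λ.V) (y : G) : H :=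
  toSubgroup hT (c.b X y) * (c.k X y)⁻¹

variable (hT : ∀ ε ∈ T, S.shift ε = 1)

/-- Applying `toSubgroup` to `b_term`, the carriers telescope to `k (init)⁻¹ * k (term)`, so the
gauge is constant along each edge of the connected graph. -/
theorem gauge_eq (X Y : Λ.V) (y : G) : c.gauge hT X y = c.gauge hT Y y := by
  refine SimpleGraph.eq_of_connected_fromEdgeSet hΛ.isTree.connected (fun X => c.gauge hT X y)
    (fun E _ => ?_) X Y
  simp only [gauge]
  rw [c.b_term, map_mul, map_mul, map_mul,
    toSubgroup_letter hT ((c.carries_k _ y).mem (c.carries_init_l E y)), toSubgroup_stable,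
    toSubgroup_letter hT ((c.carries_term_l E y).mem (c.carries_k _ y))]
  group

theorem toSubgroup_F (X : Λ.V) (y g : G) :
    toSubgroup hT (c.F y g) = c.gauge hT X y * (c.gauge hT X (y * g))⁻¹ := by
  let N : Subgroup G :=
    { carrier := {g | ∀ y, toSubgroup hT (c.F y g) = c.gauge hT X y * (c.gauge hT X (y * g))⁻¹}
      one_mem' := fun y => by rw [F_one, map_one, mul_one, mul_inv_cancel]
      mul_mem' := fun {a b} ha hb y => by
        rw [c.F_mul, map_mul, ha, hb, mul_assoc y]
        group
      inv_mem' := fun {a} ha y => by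
        have h1 := c.F_mul y a⁻¹ a
        rw [inv_mul_cancel, F_one] at h1
        rw [eq_inv_of_mul_eq_one_left h1.symm, map_inv, ha, inv_mul_cancel_right]
        group }
  have hN : N = ⊤ := by
    rw [eq_top_iff, ← closure_vertexSubgroup hD, Subgroup.closure_le]
    intro a ha y
    obtain ⟨Y, ha⟩ := Set.mem_iUnion.1 ha
    rw [c.gauge_eq hT X Y, c.gauge_eq hT X Y, c.F_eq Y _ a ha, map_mul, map_mul,
      toSubgroup_letter hT ((c.carries_k Y y).mem (c.carries_k_mul y ha)), map_inv]
    simp only [gauge]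
    group
  exact (hN ▸ Subgroup.mem_top g : g ∈ N) y

/-- The image of the cocycle is the coboundary of the gauge, and equivariance of `k` and invariance
of `b` give `gauge h = gauge 1 * h⁻¹`. -/
theorem toSubgroup_hom (X : Λ.V) (h : H) :
    toSubgroup hT (c.hom h) = c.gauge hT X 1 * h * (c.gauge hT X 1)⁻¹ := by
  have h1 : c.gauge hT X h = c.gauge hT X 1 * h⁻¹ := by
    have hk := c.k_mul X h 1
    have hb := c.b_mul X h 1
    rw [mul_one] at hk hb
    rw [gauge, gauge, hk, hb, mul_inv_rev, mul_assoc]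
  rw [hom_apply, c.toSubgroup_F hT X, one_mul, h1]
  group

/-- The conjugating element at a vertex. -/
noncomputable def conjugator (v : D.CosetVertex H) : S.graph.FundamentalGroup T :=
  c.F 1 (S.vertexRep v) * c.b v.1 (S.vertexRep v) *
    S.letter T v ((c.k v.1 (S.vertexRep v))⁻¹ * 1)

theorem carries_one (v : D.CosetVertex H) : S.Carries v 1 (S.vertexRep v) := by
  simp [Carries]

theorem carries_k_rep (v : D.CosetVertex H) :
    S.Carries v (c.k v.1 (S.vertexRep v)) (S.vertexRep v) := by
  have := c.carries_k v.1 (S.vertexRep v)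
  rwa [S.cosetVertex_vertexRep] at this

/-- With `r` the representative of `v`, evaluate `F 1 (x * r)` twice: through `x`, and through `r`
followed by `r⁻¹ * x * r`, which lies in a vertex group where `F` is explicit. -/
theorem hom_of_mem {v : D.CosetVertex H} {x : H} (hx : x ∈ S.vertexStab v) :
    c.hom x = c.conjugator v * S.letter T v x * (c.conjugator v)⁻¹ := by
  set r := S.vertexRep v with hr
  have ha : r⁻¹ * x * r ∈ D.vertexSubgroup v.1 := mem_vertexStab.1 hx
  have h1 : c.F 1 (x * r) = c.hom x * c.F 1 r := by
    have := c.F_left_mul x 1 r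
    rw [mul_one] at this
    rw [c.F_mul, one_mul, this, hom_apply]
  have h2 : c.F 1 (x * r) = c.F 1 r * c.F r (r⁻¹ * x * r) := by
    have := c.F_mul 1 r (r⁻¹ * x * r)
    rw [one_mul] at this
    rw [← this]
    group
  have h3 : r * (r⁻¹ * x * r) = x * r := by group
  have hk := c.carries_k_rep v
  have hmem : (c.k v.1 r)⁻¹ * 1 ∈ S.vertexStab v := hk.mem (carries_one v)
  have hmem' : 1⁻¹ * c.k v.1 r ∈ S.vertexStab v := (carries_one v).mem hk
  rw [c.F_eq _ _ _ ha, h3, c.k_mul, c.b_mul, S.cosetVertex_vertexRep] at h2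
  rw [eq_mul_inv_of_mul_eq (h1.symm.trans h2)]
  have h4 : S.letter T v ((c.k v.1 r)⁻¹ * (x * c.k v.1 r)) =
      S.letter T v ((c.k v.1 r)⁻¹ * 1) * S.letter T v x * (S.letter T v ((c.k v.1 r)⁻¹ * 1))⁻¹ := by
    rw [hk.inv_letter (carries_one v), ← letter_mul hmem hx, ← letter_mul (mul_mem hmem hx) hmem']
    group
  rw [h4]
  simp only [conjugator]
  rw [← hr]
  group

theorem edge_identity {P : Type*} [Group P] {X f f' b b' p A A' B B' t N C K E : P}
    (h : f * (b * A * p⁻¹) = X * f' * (b' * E * (p * (B * t * C))⁻¹))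
    (hu : A * B = A' * B') (ht : B' * t = t * N) (hv : N * C = K * E) :
    X = f * b * A' * t * (f' * b' * K⁻¹)⁻¹ := by
  have hX : X = f * b * (A * B) * t * C * E⁻¹ * b'⁻¹ * f'⁻¹ := by
    rw [← mul_inv_eq_iff_eq_mul, ← mul_inv_eq_iff_eq_mul] at h
    rw [← h]
    group
  rw [hX, hu, show f * b * (A' * B') * t * C = f * b * A' * (B' * t) * C by group, ht,
    show f * b * A' * (t * N) * C = f * b * A' * t * (N * C) by group, hv]
  group

/-- Evaluate `F 1` at the edge representative twice: through the representative of the initial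
vertex, and through the shifted representative of the terminal vertex. The potential `b` contributes
the stable letter. -/
theorem hom_shift (ε : D.CosetEdge H) :
    c.hom (S.shift ε) =
      c.conjugator (cosetInit H ε) * S.stable T ε * (c.conjugator (cosetTerm H hD ε))⁻¹ := by
  set u := cosetInit H ε with hu
  set v := cosetTerm H hD ε with hv
  set q := S.edgeRep ε with hq
  set h := S.shift ε with hh
  set r := S.vertexRep u with hr
  set s := S.vertexRep v with hs
  have hqε : D.cosetEdge H ε.1 q = ε := S.cosetEdge_edgeRep ε
  have hqu : D.cosetVertex H u.1 q = u := congrArg (cosetInit H) hqε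
  have hqv : D.cosetVertex H v.1 q = v := congrArg (cosetTerm H hD) hqε
  have ha : r⁻¹ * q ∈ D.vertexSubgroup u.1 := S.init_mem ε
  have hb : (h * s)⁻¹ * q ∈ D.vertexSubgroup v.1 := by
    have := S.term_mem ε
    rwa [← mul_inv_rev] at this
  have h1 : c.F 1 q = c.F 1 r * c.F r (r⁻¹ * q) := by
    have := c.F_mul 1 r (r⁻¹ * q)
    rwa [one_mul, mul_inv_cancel_left] at this
  have h2 : c.F 1 q = c.hom h * c.F 1 s * c.F (h * s) ((h * s)⁻¹ * q) := by
    have := c.F_mul 1 (h * s) ((h * s)⁻¹ * q)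
    rw [one_mul, mul_inv_cancel_left] at this
    rw [this, c.F_mul, one_mul, hom_apply]
    have := c.F_left_mul h 1 s
    rw [mul_one] at this
    rw [this]
  have hsv : D.cosetVertex H v.1 (h * s) = v := by
    rw [cosetVertex_mul_left _ h.2]
    exact S.cosetVertex_vertexRep v
  have hru : D.cosetVertex H u.1 r = u := S.cosetVertex_vertexRep u
  rw [c.F_eq _ _ _ ha, mul_inv_cancel_left, hru] at h1
  rw [c.F_eq _ _ _ hb, mul_inv_cancel_left, hsv, c.k_mul, c.b_mul] at h2
  have hbt := c.b_term ε.1 q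
  rw [hqε] at hbt
  change c.b v.1 q = c.b u.1 q * (S.letter T (D.cosetVertex H u.1 q) ((c.k u.1 q)⁻¹ * c.l ε.1 q) *
    S.stable T ε * S.letter T (D.cosetVertex H v.1 q) ((c.l ε.1 q * h)⁻¹ * c.k v.1 q)) at hbt
  rw [hqu, hqv] at hbt
  have ck_u := c.carries_k u.1 q
  have ck_v := c.carries_k v.1 q
  have cl_u := c.carries_init_l ε.1 q
  have cl_v := c.carries_term_l ε.1 q
  change S.Carries (D.cosetVertex H u.1 q) _ _ at cl_u
  change S.Carries (D.cosetVertex H v.1 q) _ _ at cl_v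
  rw [hqε] at cl_v
  rw [hqu] at ck_u cl_u
  rw [hqv] at ck_v cl_v
  have c1_u : S.Carries u 1 q := carries_init (ε := ε) (by simp [← hq])
  have c1_v : S.Carries v h q := by
    have := carries_term (S := S) (ε := ε) (x := 1) (y := q) (by simp [← hq])
    rwa [one_mul] at this
  have cr_u : S.Carries u (c.k u.1 r) q := by
    have := (c.carries_k_rep u).mul_right ha
    rwa [mul_inv_cancel_left] at this
  have cs_v : S.Carries v (h * c.k v.1 s) q := by
    have h3 := c.carries_k v.1 (h * s)
    rw [hsv, c.k_mul] at h3
    have := h3.mul_right hb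
    rwa [mul_inv_cancel_left] at this
  have hst : c.l ε.1 q ∈ S.edgeStab ε := by
    have h3 := c.l_mem ε.1 q
    rw [hqε] at h3
    have := inv_mem h3
    rw [mem_edgeStab]
    convert this using 1
    rw [← hq]
    group
  have hrel := letter_mul_stable (T := T) hst
  rw [← hu, ← hv, ← hh] at hrel
  rw [show h⁻¹ * c.l ε.1 q * h = h⁻¹ * (c.l ε.1 q * h) from mul_assoc _ _ _,
    show c.l ε.1 q = 1⁻¹ * c.l ε.1 q by group] at hrel
  have hu' := (cr_u.letter_mul_letter (T := T) ck_u cl_u).trans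
    (cr_u.letter_mul_letter c1_u cl_u).symm
  have hv' := (c1_v.letter_mul_letter (T := T) cl_v ck_v).trans
    (c1_v.letter_mul_letter cs_v ck_v).symm
  have hs' := cs_v.inv_letter (T := T) c1_v
  rw [show (h * c.k v.1 s)⁻¹ * h = (c.k v.1 s)⁻¹ * 1 by group] at hs'
  rw [h1, hbt] at h2
  simp only [conjugator]
  rw [← hr, ← hs, ← inv_inv (S.letter T v ((c.k v.1 s)⁻¹ * 1)), hs']
  simp only [inv_one, one_mul] at hu' hrel
  exact edge_identity h2 hu' hrel hv'

end CosetCocycle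

theorem toSubgroup_bijective (hΛ : Λ.IsSpanningTree Set.univ)
    (hTc : (SimpleGraph.fromEdgeSet
      ((fun ε => s(cosetInit H ε, cosetTerm H hD ε)) '' T)).Connected)
    (hT : ∀ ε ∈ T, S.shift ε = 1) : Function.Bijective (toSubgroup hT) := by
  obtain ⟨c⟩ := nonempty_cosetCocycle (S := S) (T := T) hΛ
  obtain ⟨X⟩ := Λ.connected.nonempty
  -- On tree edges both the shift and the stable letter are trivial, so `hom_shift` says that the
  -- conjugators at the two ends agree.
  have hconst := SimpleGraph.eq_of_connected_fromEdgeSet hTc c.conjugator (fun ε hε => by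
    have := c.hom_shift ε
    rwa [hT ε hε, map_one, stable_eq_one hε, mul_one, eq_comm, mul_inv_eq_one] at this)
  set θ := c.conjugator (D.cosetVertex H X 1)
  constructor
  · have h : c.hom.comp (toSubgroup hT) = (MulAut.conj θ).toMonoidHom := by
      refine FundamentalGroup.hom_ext (Λ := S.graph) (fun v a => ?_) (fun ε => ?_)
      · have h1 : S.graph.ofVertex T v a = S.letter T v a := (letter_of_mem a.2).symm
        rw [h1, MonoidHom.comp_apply, toSubgroup_letter hT a.2, c.hom_of_mem a.2,
          hconst v (D.cosetVertex H X 1)]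
        rfl
      · change c.hom (toSubgroup hT (S.stable T ε)) = MulAut.conj θ (S.stable T ε)
        rw [toSubgroup_stable, c.hom_shift, hconst _ (D.cosetVertex H X 1),
          hconst (cosetTerm H hD ε) (D.cosetVertex H X 1)]
        rfl
    refine Function.Injective.of_comp (f := c.hom) ?_
    have : ⇑c.hom ∘ ⇑(toSubgroup hT) = MulAut.conj θ := congrArg DFunLike.coe h
    rw [this]
    exact (MulAut.conj θ).injective
  · intro h
    refine ⟨c.hom ((c.gauge hT X 1)⁻¹ * h * c.gauge hT X 1), ?_⟩
    rw [c.toSubgroup_hom hT X]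
    group

/-- The decomposition of a subgroup given by its action on the Bass–Serre graph. -/
noncomputable def decomposition (hΛ : Λ.IsSpanningTree Set.univ) (hS : S.graph.IsSpanningTree T)
    (hT : ∀ ε ∈ T, S.shift ε = 1) : S.graph.Decomposition H where
  tree := T
  isSpanningTree := hS
  iso := MulEquiv.ofBijective _ (toSubgroup_bijective hΛ hS.isTree.connected hT)

theorem vertexSubgroup_decomposition (hΛ : Λ.IsSpanningTree Set.univ)
    (hS : S.graph.IsSpanningTree T) (hT : ∀ ε ∈ T, S.shift ε = 1) (v : D.CosetVertex H) :
    (decomposition hΛ hS hT).vertexSubgroup v = S.vertexStab v := by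
  have : (decomposition hΛ hS hT).vertexHom v = (S.vertexStab v).subtype := by
    ext x
    exact congrArg Subtype.val
      ((congrArg _ (letter_of_mem x.2).symm).trans (toSubgroup_letter hT x.2))
  rw [vertexSubgroup, this, Subgroup.range_subtype]

theorem map_vertexStab (v : D.CosetVertex H) :
    (S.vertexStab v).map H.subtype =
      H ⊓ MulAut.conj (S.vertexRep v) • D.vertexSubgroup v.1 := by
  ext x
  rw [Subgroup.mem_inf, Subgroup.mem_pointwise_smul_iff_inv_smul_mem]
  constructor
  · rintro ⟨x, hx, rfl⟩
    refine ⟨x.2, ?_⟩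
    simpa using mem_vertexStab.1 hx
  · rintro ⟨hx, hx'⟩
    exact ⟨⟨x, hx⟩, mem_vertexStab.2 (by simpa using hx'), rfl⟩

end GraphOfGroups.Decomposition.Transversal

/-! ### Coxeter groups, the subgroup theorem and the Bass–Serre tree. -/

theorem CoxeterSystem.hom_multiplicative_int_eq_one {B : Type*} {M : CoxeterMatrix B} {W : Type*}
    [Group W] (cs : CoxeterSystem M W) (f : W →* Multiplicative ℤ) (x : W) : f x = 1 := by
  have : f = 1 := by
    refine MonoidHom.eq_of_eqOn_dense cs.subgroup_closure_range_simple ?_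
    rintro _ ⟨i, rfl⟩
    have h := congrArg f (cs.simple_mul_simple_self i)
    rw [map_mul, map_one] at h
    have h' : Multiplicative.toAdd (f (cs.simple i)) + Multiplicative.toAdd (f (cs.simple i)) = 0 :=
      congrArg Multiplicative.toAdd h
    change Multiplicative.toAdd (f (cs.simple i)) = 0
    omega
  rw [this, MonoidHom.one_apply]

namespace GraphOfGroups.Decomposition

variable {Λ : GraphOfGroups.{v, e, g}} {G : Type w} [Group G] {D : Λ.Decomposition G}

/-- A subgroup `H` of the fundamental group of a tree of groups is the fundamental group of a
quotient of the Bass–Serre graph. -/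
theorem exists_decomposition_subgroup (hD : D.tree = Set.univ) (H : Subgroup G) :
    ∃ (S : Transversal hD H) (D' : S.graph.Decomposition H), ∀ v : D.CosetVertex H,
      (D'.vertexSubgroup v).map H.subtype =
        H ⊓ MulAut.conj (S.vertexRep v) • D.vertexSubgroup v.1 := by
  obtain ⟨T, hl, hp, ht⟩ := SimpleGraph.exists_spanningTree (connected_cosetGraph H hD)
  obtain ⟨S, hS⟩ := exists_transversal hD hl hp ht
  refine ⟨S, Transversal.decomposition (hD ▸ D.isSpanningTree) ⟨hl, hp, ht⟩ hS, fun v => ?_⟩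
  rw [Transversal.vertexSubgroup_decomposition, Transversal.map_vertexStab]

/-- The Bass–Serre graph of a tree of groups is a tree. -/
theorem isTree_bassSerre (hD : D.tree = Set.univ) :
    (∀ ε ε' : D.CosetEdge ⊥, s(cosetInit ⊥ ε, cosetTerm ⊥ hD ε) =
      s(cosetInit ⊥ ε', cosetTerm ⊥ hD ε') → ε = ε') ∧
    (SimpleGraph.fromEdgeSet
      (Set.range fun ε : D.CosetEdge ⊥ => s(cosetInit ⊥ ε, cosetTerm ⊥ hD ε))).IsTree := by
  obtain ⟨S, D', -⟩ := exists_decomposition_subgroup hD (⊥ : Subgroup G)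
  have hT := D'.isSpanningTree
  -- The quotient by the trivial subgroup is the Bass–Serre graph itself. It underlies a
  -- decomposition of the trivial group, so its spanning tree contains every edge.
  rw [D'.tree_eq_univ (fun f x => by rw [Subsingleton.elim x 1, map_one])] at hT
  have ht := hT.isTree
  rw [Set.image_univ] at ht
  exact ⟨fun ε ε' => hT.not_parallel ε (Set.mem_univ _) ε' (Set.mem_univ _), ht⟩

/-- Left translation on the cosets of a subgroup, written as double cosets. -/
def translate (k : G) {A : Subgroup G} :
    DoubleCoset.Quotient ((⊥ : Subgroup G) : Set G) (A : Set G) →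
      DoubleCoset.Quotient ((⊥ : Subgroup G) : Set G) (A : Set G) :=
  Quotient.lift (fun y => DoubleCoset.mk ⊥ A (k * y)) (fun x y hxy => by
    obtain ⟨a, ha, b, hb, rfl⟩ := DoubleCoset.rel_iff.1 hxy
    rw [Subgroup.mem_bot.1 ha, one_mul, ← mul_assoc, DoubleCoset.mk_mul_right _ hb])

/-- Left translation on the vertices of the Bass–Serre graph. -/
def translateVertex (k : G) (v : D.CosetVertex ⊥) : D.CosetVertex ⊥ := ⟨v.1, translate k v.2⟩

/-- Left translation on the edges of the Bass–Serre graph. -/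
def translateEdge (k : G) (ε : D.CosetEdge ⊥) : D.CosetEdge ⊥ := ⟨ε.1, translate k ε.2⟩

@[simp] theorem translateVertex_cosetVertex (k : G) (X : Λ.V) (y : G) :
    translateVertex k (D.cosetVertex ⊥ X y) = D.cosetVertex ⊥ X (k * y) := rfl

@[simp] theorem translateEdge_cosetEdge (k : G) (E : Λ.E) (y : G) :
    translateEdge k (D.cosetEdge ⊥ E y) = D.cosetEdge ⊥ E (k * y) := rfl

theorem cosetInit_translateEdge (k : G) (ε : D.CosetEdge ⊥) :
    cosetInit ⊥ (translateEdge k ε) = translateVertex k (cosetInit ⊥ ε) := by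
  obtain ⟨E, d⟩ := ε
  induction d using Quotient.ind
  rfl

theorem cosetTerm_translateEdge (hD : D.tree = Set.univ) (k : G) (ε : D.CosetEdge ⊥) :
    cosetTerm ⊥ hD (translateEdge k ε) = translateVertex k (cosetTerm ⊥ hD ε) := by
  obtain ⟨E, d⟩ := ε
  induction d using Quotient.ind
  rfl

theorem translateVertex_injective (k : G) :
    Function.Injective (translateVertex k : D.CosetVertex ⊥ → D.CosetVertex ⊥) := by
  refine Function.LeftInverse.injective (g := translateVertex k⁻¹) fun v => ?_
  obtain ⟨y, hy⟩ := exists_cosetVertex_eq v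
  rw [← hy, translateVertex_cosetVertex, translateVertex_cosetVertex, inv_mul_cancel_left]

theorem cosetVertex_bot_eq_iff {X Y : Λ.V} {y : G} :
    D.cosetVertex ⊥ X 1 = D.cosetVertex ⊥ Y y ↔ Y = X ∧ y ∈ D.vertexSubgroup X := by
  constructor
  · intro h
    have hX : X = Y := congrArg Sigma.fst h
    subst hX
    obtain ⟨b, hb, a, ha, rfl⟩ := cosetVertex_eq_iff.1 h
    rw [Subgroup.mem_bot.1 hb]
    exact ⟨rfl, by simpa using ha⟩
  · rintro ⟨rfl, h⟩
    rw [← one_mul y, cosetVertex_mul_right _ h]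

/-- A subgroup which fixes two vertices of the Bass–Serre tree fixes an edge at the first one. -/
theorem exists_le_conj_edgeSubgroup (hD : D.tree = Set.univ) {K : Subgroup G} {X Y : Λ.V} {y : G}
    (hX : K ≤ D.vertexSubgroup X) (hY : K ≤ MulAut.conj y • D.vertexSubgroup Y)
    (hne : ¬ (Y = X ∧ y ∈ D.vertexSubgroup X)) :
    ∃ z ∈ D.vertexSubgroup X, ∃ E : Λ.E, (Λ.init E = X ∨ Λ.term E = X) ∧
      K ≤ MulAut.conj z • D.edgeSubgroup E := by
  obtain ⟨hpar, htree⟩ := isTree_bassSerre hD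
  obtain ⟨p, hp, -⟩ := htree.existsUnique_path (D.cosetVertex ⊥ X 1) (D.cosetVertex ⊥ Y y)
  have hpn : ¬ p.Nil := SimpleGraph.Walk.not_nil_of_ne fun h => hne (cosetVertex_bot_eq_iff.1 h)
  obtain ⟨⟨ε, hε⟩, -⟩ := (SimpleGraph.fromEdgeSet_adj _).1 (p.adj_snd hpn)
  have hfix : ∀ k ∈ K, translateEdge k ε = ε := by
    intro k hk
    have h₁ : translateVertex k (D.cosetVertex ⊥ X 1) = D.cosetVertex ⊥ X 1 := by
      rw [translateVertex_cosetVertex, mul_one, eq_comm, cosetVertex_bot_eq_iff]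
      exact ⟨rfl, hX hk⟩
    have h₂ : translateVertex k (D.cosetVertex ⊥ Y y) = D.cosetVertex ⊥ Y y := by
      have h := hY hk
      rw [Subgroup.mem_pointwise_smul_iff_inv_smul_mem] at h
      have h' : y⁻¹ * k * y ∈ D.vertexSubgroup Y := by simpa using h
      rw [translateVertex_cosetVertex, ← cosetVertex_mul_right y h']
      congr 1
      group
    let f : SimpleGraph.fromEdgeSet
        (Set.range fun ε : D.CosetEdge ⊥ => s(cosetInit ⊥ ε, cosetTerm ⊥ hD ε)) →g
        SimpleGraph.fromEdgeSet
        (Set.range fun ε : D.CosetEdge ⊥ => s(cosetInit ⊥ ε, cosetTerm ⊥ hD ε)) :=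
      { toFun := translateVertex k
        map_rel' := by
          intro a b hab
          obtain ⟨⟨ε, hε⟩, hne⟩ := (SimpleGraph.fromEdgeSet_adj _).1 hab
          refine (SimpleGraph.fromEdgeSet_adj _).2
            ⟨⟨translateEdge k ε, ?_⟩, (translateVertex_injective k).ne hne⟩
          have := congrArg (Sym2.map (translateVertex k)) hε
          simpa [cosetInit_translateEdge, cosetTerm_translateEdge] using this }
    have hq : ((p.map f).copy h₁ h₂).IsPath := by
      rw [SimpleGraph.Walk.isPath_copy]
      exact hp.map (translateVertex_injective k)
    -- The translate of `p` by `k` is a path with the same ends, so it equals `p`; in particular its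
    -- second vertex is fixed.
    have heq := congrArg Subtype.val
      ((htree.2.subsingleton_path _ _).elim ⟨_, hq⟩ ⟨p, hp⟩)
    have h₃ : translateVertex k p.snd = p.snd := by
      have := congrArg (fun q => SimpleGraph.Walk.getVert q 1) heq
      change f p.snd = p.snd
      simpa [SimpleGraph.Walk.getVert_map] using this
    -- Both ends of the first edge are fixed, and there are no parallel edges.
    apply hpar
    have := congrArg (Sym2.map (translateVertex k)) hε
    rw [cosetInit_translateEdge, cosetTerm_translateEdge]
    simp only [Sym2.map_mk, h₁, h₃] at this
    exact this.trans hε.symm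
  obtain ⟨z, hz⟩ := exists_cosetEdge_eq ε
  have hK : K ≤ MulAut.conj z • D.edgeSubgroup ε.1 := by
    intro k hk
    have h := hfix k hk
    rw [← hz, translateEdge_cosetEdge] at h
    obtain ⟨b, hb, a, ha, he⟩ := cosetEdge_eq_iff.1 h
    rw [Subgroup.mem_bot.1 hb, one_mul] at he
    rw [Subgroup.mem_pointwise_smul_iff_inv_smul_mem]
    convert inv_mem ha using 1
    rw [eq_inv_iff_mul_eq_one]
    simp only [← map_inv, MulAut.smul_def, MulAut.conj_apply, inv_inv]
    rw [mul_assoc, mul_assoc, ← mul_assoc k]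
    change z⁻¹ * (k * z * a) = 1
    rw [← he, inv_mul_cancel]
  -- The edge may point away from or towards the base vertex. Either way that vertex is represented
  -- by `z`, so `z` lies in its group.
  rcases Sym2.eq_iff.1 hε with ⟨h, -⟩ | ⟨-, h⟩
  · rw [← hz] at h
    obtain ⟨h1, h2⟩ := cosetVertex_bot_eq_iff.1 h.symm
    exact ⟨z, h2, ε.1, Or.inl h1, hK⟩
  · rw [← hz] at h
    obtain ⟨h1, h2⟩ := cosetVertex_bot_eq_iff.1 h.symm
    exact ⟨z, h2, ε.1, Or.inr h1, hK⟩

end GraphOfGroups.Decomposition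

theorem theorem2
    {B : Type uB} [Finite B] {M : CoxeterMatrix B} {W : Type uW} [Group W]
    (cs : CoxeterSystem M W)
    (Λ : GraphOfGroups.{v₁, e₁, g₁}) (DΛ : Λ.Decomposition W)
    (Ψ : GraphOfGroups.{v₂, e₂, g₂}) (DΨ : Ψ.Decomposition W)
    (hΨ : Ψ.IsReduced)
    (hΨΛ : ∀ X : Ψ.V, ∃ (Y : Λ.V) (h : W),
      DΨ.vertexSubgroup X ≤ MulAut.conj h • DΛ.vertexSubgroup Y)
    (V : Λ.V) :
    ∃ (Φ : GraphOfGroups.{max uW v₂, max uW e₂, uW})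
      (DΦ : Φ.Decomposition (DΛ.vertexSubgroup V)),
      ∀ U : Φ.V,
        (∃ (X : Ψ.V) (h : W),
          (DΦ.vertexSubgroup U).map (DΛ.vertexSubgroup V).subtype =
            MulAut.conj h • DΨ.vertexSubgroup X) ∨
        (∃ v ∈ DΛ.vertexSubgroup V, ∃ E : Λ.E, (Λ.init E = V ∨ Λ.term E = V) ∧
          (DΦ.vertexSubgroup U).map (DΛ.vertexSubgroup V).subtype ≤
            MulAut.conj v • DΛ.edgeSubgroup E) := by
  have hΛ := DΛ.tree_eq_univ cs.hom_multiplicative_int_eq_one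
  have hΨ' := DΨ.tree_eq_univ cs.hom_multiplicative_int_eq_one
  obtain ⟨S, DΦ, hΦ⟩ :=
    GraphOfGroups.Decomposition.exists_decomposition_subgroup hΨ' (DΛ.vertexSubgroup V)
  refine ⟨S.graph, DΦ, fun U => ?_⟩
  obtain ⟨Y, h, hY⟩ := hΨΛ U.1
  rw [hΦ U]
  have hY' : MulAut.conj (S.vertexRep U) • DΨ.vertexSubgroup U.1 ≤
      MulAut.conj (S.vertexRep U * h) • DΛ.vertexSubgroup Y := by
    rw [map_mul, mul_smul]
    exact Subgroup.pointwise_smul_le_pointwise_smul_iff.2 hY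
  -- This asks whether the vertex of the Bass–Serre tree of `Λ` fixed by the conjugate of the vertex
  -- group of `Ψ` is the base vertex of `V`.
  by_cases hc : Y = V ∧ S.vertexRep U * h ∈ DΛ.vertexSubgroup V
  · obtain ⟨rfl, hc⟩ := hc
    rw [Subgroup.conj_smul_eq_self_of_mem hc] at hY'
    exact Or.inl ⟨U.1, S.vertexRep U, inf_eq_right.2 hY'⟩
  · exact Or.inr (GraphOfGroups.Decomposition.exists_le_conj_edgeSubgroup hΛ inf_le_left
      (inf_le_right.trans hY') hc)
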